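/- Let $n\ge 1$ be an integer, write $[m]=\{1,\dots,m\}$, and let $\alpha_1\ge\alpha_2\ge\dots\ge\alpha_n\ge 0$ be real numbers. For $I\subseteq[n+1]$ let $z_I=\sum_{i=1}^{|I|-1}\alpha_{n+1-i}$ if $n+1\in I$, and $z_I=0$ otherwise. Let $$\Gamma(\alpha_1,\dots,\alpha_n)=\Bigl\{x\in\mathbb R^{n+1} : \sum_{i=1}^{n+1}x_i=z_{[n+1]},\ \sum_{i\in I}x_i\le z_{[n+1]}-z_{[n+1]\setminus I}\ \text{ for all }\emptyset\ne I\subseteq[n+1]\Bigr\},$$ and let the SIM-body $\Lambda(\alpha_1,\dots,\alpha_n)\subseteq\mathbb R^n$ be the image of $\Gamma(\alpha_1,\dots,\alpha_n)$ under the projection that omits the last coordinate. Then the $n$-dimensional Lebesgue volume of $\Lambda=\Lambda(\alpha_1,\dots,\alpha_n)$ is finite and equals $$\operatorname{vol}_n(\Lambda)=\frac1{n!}\sum_{k=1}^{n}\ \sum_{L\in\binom{[n]}{k}}\ \sum_{\sigma\in\operatorname{Sym}(k)}\frac{\langle\sigma(L),\alpha^{[k]}\rangle^n}{\sigma(L)_k\cdot\prod_{i=1}^{k-1}\bigl(\sigma(L)_i-\sigma(L)_{i+1}\bigr)\cdot\prod_{i\in[n]\setminus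 L}(-i)},$$ where $\alpha^{[k]}=(\alpha_1,\dots,\alpha_k)$, each $k$-element subset $L$ of $[n]$ is sorted ascendingly to give a vector in $\mathbb R^k$, $\sigma(L)$ is the vector obtained from it by permuting its coordinates by $\sigma$, i.e. $\sigma(L)_i=L_{\sigma^{-1}(i)}$, $\langle\cdot,\cdot\rangle$ is the standard inner product, and empty products are $1$. -/

import Mathlib

open MeasureTheory
open scoped Nat Finset

noncomputable section

/-- The generalized permutahedron `P_m{z}` in `ℝ^m` given by a set function `z`: the points `x`
with `∑ i, x i = z [m]` and `∑ i ∈ I, x i ≤ z [m] - z Iᶜ` for every nonempty `I ⊆ [m]`.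
The value of `z` at the empty set (needed for `I = [m]`) is understood to be `0`. -/
def generalizedPermutahedron {m : ℕ} (z : Finset (Fin m) → ℝ) : Set (Fin m → ℝ) :=
  {x | ∑ i, x i = z Finset.univ ∧
    ∀ I : Finset (Fin m), I.Nonempty → ∑ i ∈ I, x i ≤ z Finset.univ - z Iᶜ}

/-- The set function defining the homogeneous SIM-body: if `I ⊆ [n+1]` contains `n+1`, its value
is the sum of the last `|I| - 1` parameters `α_n + α_{n-1} + ⋯`; otherwise it is `0`.
The parameter `α_{i+1}` is `α i`, since `Fin n` starts at `0`. -/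
def simHeight {n : ℕ} (α : Fin n → ℝ) (I : Finset (Fin (n + 1))) : ℝ :=
  if Fin.last n ∈ I then ∑ j ∈ Finset.univ.filter (fun j : Fin n => (j : ℕ) + 1 < #I), α j.rev else 0

/-- The homogeneous SIM-body `Γ(α_1, …, α_n) ⊆ ℝ^{n+1}`. -/
def homogeneousSIMBody {n : ℕ} (α : Fin n → ℝ) : Set (Fin (n + 1) → ℝ) :=
  generalizedPermutahedron (simHeight α)

/-- The SIM-body `Λ(α_1, …, α_n) ⊆ ℝ^n`: the image of `Γ(α_1, …, α_n)` under the projection which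
omits the last coordinate. -/
def simBody {n : ℕ} (α : Fin n → ℝ) : Set (Fin n → ℝ) :=
  (fun x : Fin (n + 1) → ℝ => fun i : Fin n => x i.castSucc) '' homogeneousSIMBody α

/-- A `k`-element subset `L` of `[n]`, sorted ascendingly, as a vector in `ℝ^k`.
The element `i : Fin n` stands for the number `i + 1 ∈ [n]`. -/
def sortedVector {n k : ℕ} (L : {L : Finset (Fin n) // #L = k}) : Fin k → ℝ :=
  fun i => ((L.1.orderEmbOfFin L.2 i : Fin n) : ℝ) + 1

/-- The action of a permutation on a vector by permuting coordinates,
`σ(v)_i = v_{σ⁻¹(i)}`. -/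
def permuteVector {k : ℕ} (σ : Equiv.Perm (Fin k)) (v : Fin k → ℝ) : Fin k → ℝ :=
  fun i => v (σ⁻¹ i)

end

/-!
The proof goes by induction on the dimension, slicing the body along one coordinate.

After eliminating the last coordinate, the SIM-body is the polymatroid `weakMajorizationBody n α`
of all `x ≥ 0` such that any `k` coordinates of `x` sum to at most `α₀ + ⋯ + α_{k-1}`
(`simBody_eq_weakMajorizationBody`). This class of bodies is closed under slicing: for
`t ∈ [α_{j+1}, α_j]` the slice `x₀ = t` is the body one dimension lower with parameters
`α₀, …, α_{j-1}, α_j + α_{j+1} - t, α_{j+2}, …` (`cons_mem_weakMajorizationBody_iff`). Hence the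
volume is a sum of one-dimensional integrals of lower-dimensional volumes
(`volume_real_weakMajorizationBody_succ`).

A vertex is given by a list `l` of distinct coordinates, which take the values `α₀, α₁, …`, all
others being zero. The formula to be proved is that for every linear functional `c` with distinct
nonzero entries and every real shift `s`, the volume is
`∑ₗ (s + ⟨c, vₗ⟩)ⁿ / (n! · Dₗ)`, where `Dₗ` is the product of the consecutive differences of
`c l₁, …, c lₖ, 0` and of the `-cᵢ` for `i` outside `l` (`volume_real_weakMajorizationBody`).
Since the shift is arbitrary, the induction hypothesis for the slice at height `t` may be used with
the shift `s + c₀ t`. The integrand is then a power of an affine function of `t`, and its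
integral between two breakpoints is a difference of values at two vertices in which the new
coordinate `0` occupies adjacent places of the list. Collecting, for each vertex, the two integrals
to which it contributes gives the right coefficient by a partial fraction identity
(`sum_insertIdx_div_listDen`, `sum_integral_listDot_sliceParam`).

The theorem is the case `c = (1, …, n)`, `s = 0`, in which the empty list contributes nothing; the
nonempty lists of distinct coordinates correspond to the pairs `(L, σ)`
(`sum_nodup_list_eq_sum_permutedList`).
-/

/-! ### Insertion of a weight into a list -/

/-- The pairing `∑ wᵢ αᵢ` of a finite list of weights with a sequence. -/
def listDot : List ℝ → (ℕ → ℝ) → ℝ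
  | [], _ => 0
  | a :: w, α => a * α 0 + listDot w fun i => α (i + 1)

/-- The product `(w₁ - w₂) ⋯ (w_{k-1} - w_k) w_k`, i.e. the product of consecutive differences of
the list extended by a final zero. -/
def listDen : List ℝ → ℝ
  | [] => 1
  | a :: w => (a - w.headD 0) * listDen w

/-- The sequence `α₀, …, α_{j-1}, α_j + α_{j+1} - t, α_{j+2}, …`: the parameters of the slice
at height `t ∈ [α_{j+1}, α_j]`. -/
def sliceParam (α : ℕ → ℝ) (j : ℕ) (t : ℝ) (k : ℕ) : ℝ :=
  if k < j then α k else if k = j then α j + α (j + 1) - t else α (k + 1)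

/-- The hypothesis says that the entries of `w` are distinct and nonzero. -/
theorem listDen_ne_zero {w : List ℝ} (hw : (w ++ [0]).Nodup) : listDen w ≠ 0 := by
  induction w with
  | nil => simp [listDen]
  | cons a w ih =>
    simp only [List.cons_append, List.nodup_cons] at hw
    refine mul_ne_zero (sub_ne_zero.2 ?_) (ih hw.2)
    rintro rfl
    apply hw.1
    cases w <;> simp

theorem sliceParam_succ_tail (α : ℕ → ℝ) (j : ℕ) (t : ℝ) :
    (fun i => sliceParam α (j + 1) t (i + 1)) = sliceParam (fun i => α (i + 1)) j t := by
  funext i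
  simp [sliceParam]

/-- The left side is the value of the functional at a vertex `w` of the slice at height `t`, seen
as a point of the whole body. It is affine in `t`, and at `t = α j` that point is the vertex
obtained by inserting `c` at position `j`. -/
theorem listDot_sliceParam (c : ℝ) (w : List ℝ) (α : ℕ → ℝ) (j : ℕ) (hj : j < w.length) (t : ℝ) :
    c * t + listDot w (sliceParam α j t) =
      listDot (w.insertIdx j c) α + (c - w.getD j 0) * (t - α j) := by
  induction w generalizing α j with
  | nil => simp at hj
  | cons a w ih =>
    cases j with
    | zero =>
      simp [listDot, sliceParam]
      ring
    | succ j =>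
      have := ih (fun i => α (i + 1)) j (by simpa using hj)
      simp only [listDot, List.insertIdx_succ_cons, List.getD_cons_succ, sliceParam_succ_tail]
      have h0 : sliceParam α (j + 1) t 0 = α 0 := by simp [sliceParam]
      rw [h0]
      linarith

/-- Together with `listDot_sliceParam`: at the other endpoint `t = α (j + 1)` one gets the vertex
with `c` inserted at position `j + 1`. -/
theorem listDot_insertIdx_succ (c : ℝ) (w : List ℝ) (α : ℕ → ℝ) (j : ℕ) (hj : j < w.length) :
    listDot (w.insertIdx (j + 1) c) α =
      listDot (w.insertIdx j c) α + (c - w.getD j 0) * (α (j + 1) - α j) := by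
  induction w generalizing α j with
  | nil => simp at hj
  | cons a w ih =>
    cases j with
    | zero =>
      simp [listDot]
      ring
    | succ j =>
      have := ih (fun i => α (i + 1)) j (by simpa using hj)
      simp only [listDot, List.insertIdx_succ_cons, List.getD_cons_succ]
      linarith

theorem listDot_congr (w : List ℝ) {α β : ℕ → ℝ} (h : ∀ i < w.length, α i = β i) :
    listDot w α = listDot w β := by
  induction w generalizing α β with
  | nil => rfl
  | cons a w ih =>
    simp only [listDot]
    rw [h 0 (by simp), ih fun i hi => h (i + 1) (by simpa using hi)]

theorem listDot_insertIdx_length (c : ℝ) (w : List ℝ) (α : ℕ → ℝ) :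
    listDot (w.insertIdx w.length c) α = listDot w α + c * α w.length := by
  induction w generalizing α with
  | nil => simp [listDot]
  | cons a w ih =>
    simp only [listDot, List.length_cons, List.insertIdx_succ_cons]
    rw [ih]
    ring

/-- Partial fractions: summing over all positions at which a new weight `c` is inserted. On the
right, `Φ p` for `0 < p` has coefficient `1 / (c - w_p) - 1 / (c - w_{p-1})`, where the entry of `w`
after the last one is read as zero. -/
theorem sum_insertIdx_div_listDen (c : ℝ) (hc : c ≠ 0) (w : List ℝ)
    (hw : (w ++ [0]).Nodup) (hcw : c ∉ w) (Φ : ℕ → ℝ) :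
    ∑ p ∈ Finset.range (w.length + 1), Φ p / listDen (w.insertIdx p c) =
      ((∑ j ∈ Finset.range w.length, (Φ j - Φ (j + 1)) / (c - w.getD j 0)) + Φ w.length / c) /
        listDen w := by
  induction w generalizing Φ with
  | nil => simp [listDen]
  | cons a w ih =>
    have hden := listDen_ne_zero hw
    simp only [List.cons_append, List.nodup_cons] at hw
    simp only [List.mem_cons, not_or] at hcw
    have ih := ih hw.2 hcw.2 fun p => Φ (p + 1)
    rw [List.length_cons, Finset.sum_range_succ', Finset.sum_range_succ' _ w.length]
    rw [Finset.sum_range_succ'] at ih ⊢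
    simp only [List.insertIdx_succ_cons, List.insertIdx_zero, List.getD_cons_succ,
      List.getD_cons_zero] at ih ⊢
    have hhead : ∀ p, (w.insertIdx (p + 1) c).headD 0 = w.headD 0 := by
      intro p
      cases w <;> simp
    have hch : c - w.headD 0 ≠ 0 := by
      refine sub_ne_zero.2 ?_
      cases w with
      | nil => simpa using hc
      | cons b w => simpa using fun h => hcw.2 (by simp [h])
    have hac : c - a ≠ 0 := sub_ne_zero.2 hcw.1
    have hac' : a - c ≠ 0 := sub_ne_zero.2 (Ne.symm hcw.1)
    simp only [listDen, hhead, List.headD_cons] at ih hden ⊢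
    obtain ⟨hah, hw0⟩ := mul_ne_zero_iff.1 hden
    have e : ∀ p, Φ (p + 1 + 1) / ((a - w.headD 0) * listDen (w.insertIdx (p + 1) c)) =
        Φ (p + 1 + 1) / listDen (w.insertIdx (p + 1) c) / (a - w.headD 0) := by
      intro p
      rw [div_div, mul_comm]
    simp only [e]
    rw [← Finset.sum_div, eq_sub_of_add_eq ih]
    simp only [zero_add]
    field_simp
    ring

/-! ### Integrals over the slice parameter -/

theorem integral_affine_pow_div_factorial (n : ℕ) (b m x y : ℝ) (hm : m ≠ 0) :
    ∫ t in x..y, (b + m * t) ^ n / (n ! : ℝ) =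
      ((b + m * y) ^ (n + 1) / ((n + 1)! : ℝ) - (b + m * x) ^ (n + 1) / ((n + 1)! : ℝ)) / m := by
  have hd : ∀ t : ℝ, HasDerivAt (fun t => (b + m * t) ^ (n + 1) / ((n + 1)! : ℝ) / m)
      ((b + m * t) ^ n / (n ! : ℝ)) t := by
    intro t
    have h1 : HasDerivAt (fun t => b + m * t) m t := by
      simpa using ((hasDerivAt_id t).const_mul m).const_add b
    refine (((h1.pow (n + 1)).div_const ((n + 1)! : ℝ)).div_const m).congr_deriv ?_
    rw [Nat.factorial_succ]
    push_cast
    have : (n ! : ℝ) ≠ 0 := by positivity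
    field_simp
  rw [intervalIntegral.integral_eq_sub_of_hasDerivAt (fun t _ => hd t)
    (Continuous.intervalIntegrable (by fun_prop) _ _)]
  ring

theorem listDot_sliceParam_of_length_le (w : List ℝ) (α : ℕ → ℝ) (j : ℕ) (hj : w.length ≤ j)
    (t : ℝ) : listDot w (sliceParam α j t) = listDot w α :=
  listDot_congr w fun i hi => by simp [sliceParam, hi.trans_le hj]

/-- Integrating the contribution of one vertex `w` over all slices yields the contributions of
the vertices obtained by inserting `c` into `w`, together with that of `w` itself. -/
theorem sum_integral_listDot_sliceParam (n : ℕ) (c : ℝ) (hc : c ≠ 0) (w : List ℝ)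
    (hw : (w ++ [0]).Nodup) (hcw : c ∉ w) (hwn : w.length ≤ n) (α : ℕ → ℝ)
    (hα : α (n + 1) = 0) (s : ℝ) :
    ∑ j ∈ Finset.range (n + 1),
        (∫ t in α (j + 1)..α j, (s + c * t + listDot w (sliceParam α j t)) ^ n / (n ! : ℝ)) /
          listDen w =
      ∑ p ∈ Finset.range (w.length + 1),
          (s + listDot (w.insertIdx p c) α) ^ (n + 1) / ((n + 1)! : ℝ) /
            listDen (w.insertIdx p c) +
        (s + listDot w α) ^ (n + 1) / ((n + 1)! : ℝ) / (listDen w * -c) := by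
  rw [sum_insertIdx_div_listDen c hc w hw hcw
    (fun p => (s + listDot (w.insertIdx p c) α) ^ (n + 1) / ((n + 1)! : ℝ)), ← Finset.sum_div]
  have hlow : ∀ j ∈ Finset.range w.length,
      (∫ t in α (j + 1)..α j, (s + c * t + listDot w (sliceParam α j t)) ^ n / (n ! : ℝ)) =
      ((s + listDot (w.insertIdx j c) α) ^ (n + 1) / ((n + 1)! : ℝ) -
        (s + listDot (w.insertIdx (j + 1) c) α) ^ (n + 1) / ((n + 1)! : ℝ)) /
          (c - w.getD j 0) := by
    intro j hj
    rw [Finset.mem_range] at hj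
    have hm : c - w.getD j 0 ≠ 0 := by
      refine sub_ne_zero.2 ?_
      rintro rfl
      apply hcw
      rw [List.getD_eq_getElem _ _ hj]
      exact List.getElem_mem hj
    have e : ∀ t, s + c * t + listDot w (sliceParam α j t) =
        (s + listDot (w.insertIdx j c) α - (c - w.getD j 0) * α j) + (c - w.getD j 0) * t := by
      intro t
      rw [add_assoc, listDot_sliceParam c w α j hj t]
      ring
    simp only [e]
    rw [integral_affine_pow_div_factorial _ _ _ _ _ hm, listDot_insertIdx_succ c w α j hj]
    ring_nf
  -- Beyond the length of `w` the contributions telescope.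
  have hhigh : ∀ i, (∫ t in α (w.length + i + 1)..α (w.length + i),
        (s + c * t + listDot w (sliceParam α (w.length + i) t)) ^ n / (n ! : ℝ)) =
      (s + listDot w α + c * α (w.length + i)) ^ (n + 1) / ((n + 1)! : ℝ) / c -
        (s + listDot w α + c * α (w.length + (i + 1))) ^ (n + 1) / ((n + 1)! : ℝ) / c := by
    intro i
    have e : ∀ t, s + c * t + listDot w (sliceParam α (w.length + i) t) =
        s + listDot w α + c * t := by
      intro t
      rw [listDot_sliceParam_of_length_le _ _ _ (by omega)]
      ring
    simp only [e]
    rw [integral_affine_pow_div_factorial _ _ _ _ _ hc, sub_div, add_assoc w.length]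
  obtain ⟨d, hd⟩ := Nat.exists_eq_add_of_le hwn
  have hnd : n + 1 = w.length + (d + 1) := by omega
  have hend : α (w.length + (d + 1)) = 0 := by rw [← hnd, hα]
  have hsum : ∀ f : ℕ → ℝ, ∑ j ∈ Finset.range (n + 1), f j =
      ∑ j ∈ Finset.range w.length, f j + ∑ i ∈ Finset.range (d + 1), f (w.length + i) := by
    intro f
    rw [hnd, Finset.sum_range_add]
  rw [hsum, Finset.sum_congr rfl hlow, Finset.sum_congr rfl fun i _ => hhigh i,
    Finset.sum_range_sub' (fun i => (s + listDot w α + c * α (w.length + i)) ^ (n + 1) /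
      ((n + 1)! : ℝ) / c), hend, listDot_insertIdx_length]
  have := listDen_ne_zero hw
  simp only [add_zero, mul_zero, add_div, sub_div, ← add_assoc]
  field_simp
  ring

/-! ### Slices of the polymatroid -/

/-- The polymatroid of all `x ≥ 0` in `ℝⁿ` such that any `k` coordinates of `x` have sum at most
`α₀ + ⋯ + α_{k-1}`. Only the first `n` terms of the sequence matter. -/
def weakMajorizationBody (n : ℕ) (α : ℕ → ℝ) : Set (Fin n → ℝ) :=
  {x | (∀ i, 0 ≤ x i) ∧ ∀ I : Finset (Fin n), ∑ i ∈ I, x i ≤ ∑ i ∈ Finset.range #I, α i}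

theorem weakMajorizationBody_congr {n : ℕ} {α β : ℕ → ℝ} (h : ∀ i < n, α i = β i) :
    weakMajorizationBody n α = weakMajorizationBody n β := by
  have : ∀ I : Finset (Fin n), ∑ i ∈ Finset.range #I, α i = ∑ i ∈ Finset.range #I, β i := by
    intro I
    refine Finset.sum_congr rfl fun i hi => h i ?_
    have := Finset.card_le_univ I
    simp at this hi
    omega
  simp [weakMajorizationBody, this]

theorem sum_range_sliceParam_of_le (α : ℕ → ℝ) (j : ℕ) (t : ℝ) (m : ℕ) (hm : m ≤ j) :
    ∑ i ∈ Finset.range m, sliceParam α j t i = ∑ i ∈ Finset.range m, α i :=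
  Finset.sum_congr rfl fun i hi => by
    simp [sliceParam, (Finset.mem_range.1 hi).trans_le hm]

theorem sum_range_sliceParam_of_lt (α : ℕ → ℝ) (j : ℕ) (t : ℝ) (m : ℕ) (hm : j < m) :
    ∑ i ∈ Finset.range m, sliceParam α j t i = ∑ i ∈ Finset.range (m + 1), α i - t := by
  induction m, hm using Nat.le_induction with
  | base =>
    rw [Finset.sum_range_succ, sum_range_sliceParam_of_le _ _ _ _ le_rfl,
      Finset.sum_range_succ _ (j + 1), Finset.sum_range_succ]
    simp [sliceParam]
    ring
  | succ m hm ih =>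
    rw [Finset.sum_range_succ, ih, Finset.sum_range_succ _ (m + 1)]
    have h1 : ¬ m < j := by omega
    have h2 : m ≠ j := by omega
    simp [sliceParam, h1, h2]
    ring

theorem sliceParam_antitone {α : ℕ → ℝ} (hα : Antitone α) {j : ℕ} {t : ℝ}
    (ht : t ∈ Set.Icc (α (j + 1)) (α j)) : Antitone (sliceParam α j t) := by
  refine antitone_nat_of_succ_le fun k => ?_
  have h1 := hα (Nat.le_succ k)
  have h2 := hα (Nat.le_succ (k + 1))
  obtain ⟨h3, h4⟩ := ht
  simp only [Nat.succ_eq_add_one] at h1 h2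
  rcases lt_trichotomy (k + 1) j with h | h | h
  · simp [sliceParam, h, show k < j by omega, h1]
  · subst h
    simp [sliceParam]
    linarith
  · rcases eq_or_ne k j with rfl | h'
    · simp [sliceParam]
      linarith
    · simp [sliceParam, show ¬ k < j by omega, h', show ¬ k + 1 < j by omega,
        show k + 1 ≠ j by omega, h2]

theorem sliceParam_nonneg {α : ℕ → ℝ} (hα0 : ∀ i, 0 ≤ α i) {j : ℕ} {t : ℝ}
    (ht : t ≤ α j) (k : ℕ) : 0 ≤ sliceParam α j t k := by
  have := hα0 (j + 1)
  unfold sliceParam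
  split_ifs
  · exact hα0 k
  · linarith
  · exact hα0 _

theorem Fin.sum_finset_succ {n : ℕ} {M : Type*} [AddCommMonoid M] (I : Finset (Fin (n + 1)))
    (f : Fin (n + 1) → M) :
    ∑ i ∈ I, f i = (if 0 ∈ I then f 0 else 0) +
      ∑ i ∈ Finset.univ.filter (fun i : Fin n => i.succ ∈ I), f i.succ := by
  rw [← Finset.univ_inter I, ← Finset.sum_ite_mem, Fin.sum_univ_succ, Finset.sum_filter]
  simp

/-- Slices of the body are bodies of the same kind. -/
theorem cons_mem_weakMajorizationBody_iff {n : ℕ} {α : ℕ → ℝ} (hα : Antitone α)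
    (hα0 : ∀ i, 0 ≤ α i) {j : ℕ} {t : ℝ} (ht : t ∈ Set.Icc (α (j + 1)) (α j)) (x : Fin n → ℝ) :
    (Fin.cons t x : Fin (n + 1) → ℝ) ∈ weakMajorizationBody (n + 1) α ↔
      x ∈ weakMajorizationBody n (sliceParam α j t) := by
  have ht0 : 0 ≤ t := (hα0 _).trans ht.1
  -- The `m`-th partial sum of the slice parameters is the smaller of the bounds coming from the
  -- subsets that avoid and that contain the coordinate `0`.
  have key : ∀ (m : ℕ) (y : ℝ), y ≤ ∑ i ∈ Finset.range m, sliceParam α j t i ↔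
      y ≤ ∑ i ∈ Finset.range m, α i ∧ t + y ≤ ∑ i ∈ Finset.range (m + 1), α i := by
    intro m y
    rcases le_or_gt m j with h | h
    · rw [sum_range_sliceParam_of_le _ _ _ _ h, Finset.sum_range_succ]
      have := hα h
      have := ht.2
      exact ⟨fun h => ⟨h, by linarith⟩, fun h => h.1⟩
    · rw [sum_range_sliceParam_of_lt _ _ _ _ h, Finset.sum_range_succ]
      have := hα (show j + 1 ≤ m from h)
      have := ht.1
      exact ⟨fun h => ⟨by linarith, by linarith⟩, fun h => by linarith [h.2]⟩
  constructor
  · rintro ⟨h0, h⟩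
    refine ⟨fun i => by simpa using h0 i.succ, fun I => (key _ _).2 ⟨?_, ?_⟩⟩
    · simpa using h (I.map (Fin.succEmb n))
    · have := h (Finset.cons 0 (I.map (Fin.succEmb n)) (by simp))
      simpa only [Finset.sum_cons, Finset.sum_map, Finset.card_cons, Finset.card_map,
        Fin.cons_zero, Fin.coe_succEmb, Fin.cons_succ] using this
  · rintro ⟨h0, h⟩
    refine ⟨Fin.cases (by simpa using ht0) (by simpa using h0), fun I => ?_⟩
    obtain ⟨h1, h2⟩ := (key _ _).1 (h (Finset.univ.filter (fun i : Fin n => i.succ ∈ I)))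
    have hcard : #I =
        (if 0 ∈ I then 1 else 0) + #(Finset.univ.filter (fun i : Fin n => i.succ ∈ I)) := by
      simpa only [Finset.card_eq_sum_ones] using Fin.sum_finset_succ (M := ℕ) I fun _ => 1
    rw [Fin.sum_finset_succ, hcard]
    split_ifs
    · simpa [add_comm 1] using h2
    · simpa using h1

/-! ### Cavalieri's principle and lists with distinct entries -/

theorem isClosed_weakMajorizationBody (n : ℕ) (α : ℕ → ℝ) :
    IsClosed (weakMajorizationBody n α) := by
  simp only [weakMajorizationBody, Set.ofPred_and, Set.ofPred_forall]
  refine (isClosed_iInter fun i => ?_).inter (isClosed_iInter fun I => ?_)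
  · exact isClosed_le (by fun_prop) (by fun_prop)
  · exact isClosed_le (by fun_prop) (by fun_prop)

theorem weakMajorizationBody_subset_Icc (n : ℕ) (α : ℕ → ℝ) :
    weakMajorizationBody n α ⊆ Set.Icc 0 fun _ => α 0 := by
  rintro x ⟨h0, h⟩
  exact ⟨h0, fun i => by simpa using h {i}⟩

theorem volume_weakMajorizationBody_ne_top (n : ℕ) (α : ℕ → ℝ) :
    volume (weakMajorizationBody n α) ≠ ⊤ :=
  measure_ne_top_of_subset (weakMajorizationBody_subset_Icc n α) isCompact_Icc.measure_ne_top

/-- Cavalieri's principle for the first coordinate. -/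
theorem volume_real_eq_integral_cons {n : ℕ} {S : Set (Fin (n + 1) → ℝ)} (hS : MeasurableSet S)
    (hfin : volume S ≠ ⊤) :
    volume.real S =
      ∫ t : ℝ, volume.real {x : Fin n → ℝ | (Fin.cons t x : Fin (n + 1) → ℝ) ∈ S} := by
  have hmp := (volume_preserving_piFinSuccAbove (fun _ : Fin (n + 1) => ℝ) 0).symm
  set e := (MeasurableEquiv.piFinSuccAbove (fun _ : Fin (n + 1) => ℝ) 0).symm
  have he : ∀ (t : ℝ) (x : Fin n → ℝ), e (t, x) = (Fin.cons t x : Fin (n + 1) → ℝ) := by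
    intro t x
    simp [e, MeasurableEquiv.piFinSuccAbove, Fin.insertNthEquiv]
  have hS' : MeasurableSet (e ⁻¹' S) := e.measurable hS
  have h1 : volume S = volume (e ⁻¹' S) := (hmp.measure_preimage_equiv S).symm
  have h2 : ∀ t, Prod.mk t ⁻¹' (e ⁻¹' S) =
      {x : Fin n → ℝ | (Fin.cons t x : Fin (n + 1) → ℝ) ∈ S} := by
    intro t
    ext x
    simp [← he]
  have h3 := Measure.prod_apply (μ := (volume : Measure ℝ))
    (ν := (volume : Measure (Fin n → ℝ))) hS'
  rw [h1] at hfin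
  have hm := measurable_measure_prodMk_left (ν := (volume : Measure (Fin n → ℝ))) hS'
  simp only [Measure.real, ← h2]
  rw [integral_toReal hm.aemeasurable, ← h3, h1]
  · rfl
  · refine ae_lt_top hm ?_
    rw [← h3]
    exact hfin

/-- The breakpoints `α (n + 1) = 0 ≤ α n ≤ ⋯ ≤ α 0` cut the range of the first coordinate into
intervals, on each of which the slices are described by `sliceParam`. -/
theorem volume_real_weakMajorizationBody_succ (n : ℕ) {α : ℕ → ℝ} (hα : Antitone α)
    (hα0 : ∀ i, 0 ≤ α i) (hend : α (n + 1) = 0)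
    (hint : ∀ j < n + 1, ContinuousOn
      (fun t => volume.real (weakMajorizationBody n (sliceParam α j t)))
      (Set.Icc (α (j + 1)) (α j))) :
    volume.real (weakMajorizationBody (n + 1) α) =
      ∑ j ∈ Finset.range (n + 1), ∫ t in α (j + 1)..α j,
        volume.real (weakMajorizationBody n (sliceParam α j t)) := by
  rw [volume_real_eq_integral_cons (isClosed_weakMajorizationBody _ _).measurableSet
    (volume_weakMajorizationBody_ne_top _ _)]
  set f : ℝ → ℝ := fun t =>
    volume.real {x : Fin n → ℝ | (Fin.cons t x : Fin (n + 1) → ℝ) ∈ weakMajorizationBody (n + 1) α}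
  have hf : ∀ j, Set.EqOn f (fun t => volume.real (weakMajorizationBody n (sliceParam α j t)))
      (Set.Icc (α (j + 1)) (α j)) := by
    intro j t ht
    simp only [f, cons_mem_weakMajorizationBody_iff hα hα0 ht, Set.ofPred_mem_eq]
  have hout : ∀ t, t ∉ Set.Icc 0 (α 0) → f t = 0 := by
    intro t ht
    have : {x : Fin n → ℝ | (Fin.cons t x : Fin (n + 1) → ℝ) ∈ weakMajorizationBody (n + 1) α}
        = ∅ := by
      refine Set.eq_empty_of_forall_notMem fun x hx => ht ?_
      have := weakMajorizationBody_subset_Icc _ _ hx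
      exact ⟨by simpa using this.1 0, by simpa using this.2 0⟩
    simp only [f, this, measureReal_empty]
  rw [← setIntegral_eq_integral_of_forall_compl_eq_zero hout, integral_Icc_eq_integral_Ioc,
    ← intervalIntegral.integral_of_le (hα0 0), intervalIntegral.integral_symm, ← hend,
    ← intervalIntegral.sum_integral_adjacent_intervals, ← Finset.sum_neg_distrib]
  · refine Finset.sum_congr rfl fun j _ => ?_
    rw [← intervalIntegral.integral_symm]
    refine intervalIntegral.integral_congr ?_
    rw [Set.uIcc_of_le (hα (Nat.le_succ j))]
    exact hf j
  · intro j hj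
    refine ContinuousOn.intervalIntegrable ?_
    rw [Set.uIcc_of_ge (hα (Nat.le_succ j))]
    exact (hint j hj).congr (hf j)

theorem List.Nodup.insertIdx_of_notMem {ι : Type*} {l : List ι} (h : l.Nodup) {a : ι} (ha : a ∉ l)
    {p : ℕ} (hp : p ≤ l.length) : (l.insertIdx p a).Nodup :=
  (List.perm_insertIdx a l hp).nodup_iff.2 (List.nodup_cons.2 ⟨ha, h⟩)

/-- A duplicate-free list in `Fin (n + 1)` either avoids `0`, or arises from such a list by
inserting `0` at some position. -/
theorem sum_nodup_list_fin_succ {n : ℕ} (g : List (Fin (n + 1)) → ℝ) :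
    ∑ l : {l : List (Fin (n + 1)) // l.Nodup}, g l.1 =
      ∑ l : {l : List (Fin n) // l.Nodup},
        (∑ p ∈ Finset.range (l.1.length + 1), g ((l.1.map Fin.succ).insertIdx p 0) +
          g (l.1.map Fin.succ)) := by
  have hinj := Fin.succ_injective n
  have hz : ∀ l : List (Fin n), (0 : Fin (n + 1)) ∉ l.map Fin.succ := by
    intro l
    simp [Fin.succ_ne_zero]
  have hlift : ∀ l : List (Fin (n + 1)), 0 ∉ l → ∃ l' : List (Fin n), l'.map Fin.succ = l := by
    intro l
    induction l with
    | nil => exact fun _ => ⟨[], rfl⟩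
    | cons a l ih =>
      intro h
      simp only [List.mem_cons, not_or] at h
      obtain ⟨l', rfl⟩ := ih h.2
      obtain ⟨b, rfl⟩ := Fin.exists_succ_eq.2 (Ne.symm h.1)
      exact ⟨b :: l', rfl⟩
  rw [Finset.sum_add_distrib, Finset.sum_sigma',
    ← Finset.sum_filter_add_sum_filter_not Finset.univ (fun l => (0 : Fin (n + 1)) ∈ l.1)]
  congr 1
  · symm
    refine Finset.sum_bij (fun x hx => ⟨(x.1.1.map Fin.succ).insertIdx x.2 0, ?_⟩) ?_ ?_ ?_ ?_
    · simp only [Finset.mem_sigma, Finset.mem_range] at hx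
      exact (x.1.2.map hinj).insertIdx_of_notMem (hz _) (by simp; omega)
    · rintro ⟨l, p⟩ hx
      simp only [Finset.mem_sigma, Finset.mem_range, Finset.mem_univ, true_and] at hx
      simp only [Finset.mem_filter, Finset.mem_univ, true_and]
      rw [List.mem_insertIdx (by simp; omega)]
      exact Or.inl rfl
    · rintro ⟨⟨l, hl⟩, p⟩ hx ⟨⟨l', hl'⟩, p'⟩ hx' h
      simp only [Finset.mem_sigma, Finset.mem_range, Finset.mem_univ, true_and] at hx hx'
      simp only [Subtype.mk.injEq] at h
      -- The position of the inserted `0` can be read off as its first index.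
      have hidx : ∀ (l : List (Fin n)) (p : ℕ), p ≤ l.length →
          ((l.map Fin.succ).insertIdx p 0).idxOf 0 = p := by
        intro l
        induction l with
        | nil => intro p hp; simp at hp; simp [hp]
        | cons a l ih =>
          intro p hp
          cases p with
          | zero => simp
          | succ p => simp [List.idxOf_cons_ne, ih p (by simpa using hp), Fin.succ_ne_zero]
      have hp : p = p' := by
        rw [← hidx l p (by omega), h, hidx l' p' (by omega)]
      subst hp
      have := List.insertIdx_injective p _ h
      have := hinj.list_map this
      subst this
      rfl
    · rintro ⟨l, hl⟩ h0
      simp only [Finset.mem_filter, Finset.mem_univ, true_and] at h0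
      have hi := List.idxOf_lt_length_iff.2 h0
      have h2 : 0 ∉ l.eraseIdx (l.idxOf 0) := by
        rw [← List.erase_eq_eraseIdx_of_idxOf rfl]
        exact hl.not_mem_erase
      obtain ⟨l', hl'⟩ := hlift _ h2
      have hnd : (l.eraseIdx (l.idxOf 0)).Nodup := hl.eraseIdx _
      rw [← hl'] at hnd
      have hlen := congrArg List.length hl'
      rw [List.length_map, List.length_eraseIdx_of_lt hi] at hlen
      refine ⟨⟨⟨l', hnd.of_map _⟩, l.idxOf 0⟩, by simp; omega, ?_⟩
      simp only [Subtype.mk.injEq, hl']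
      have := List.insertIdx_eraseIdx_getElem hi
      rwa [List.getElem_idxOf] at this
    · intros; rfl
  · symm
    refine Finset.sum_bij (fun l _ => ⟨l.1.map Fin.succ, l.2.map hinj⟩) ?_ ?_ ?_ ?_
    · intro l _
      simp [Fin.succ_ne_zero]
    · rintro ⟨l, hl⟩ _ ⟨l', hl'⟩ _ h
      simp only [Subtype.mk.injEq] at h ⊢
      exact hinj.list_map h
    · rintro ⟨l, hl⟩ h0
      simp only [Finset.mem_filter, Finset.mem_univ, true_and] at h0
      obtain ⟨l', rfl⟩ := hlift l h0
      exact ⟨⟨l', hl.of_map _⟩, Finset.mem_univ _, rfl⟩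
    · intros; rfl

/-! ### The volume of the polymatroid -/

/-- The product of the factors `-cᵢ` over the coordinates `i` outside the list `l`. -/
def complProd {n : ℕ} (c : Fin n → ℝ) (l : List (Fin n)) : ℝ :=
  ∏ i, if i ∈ l then 1 else -c i

theorem complProd_map_succ {n : ℕ} (c : Fin (n + 1) → ℝ) (l : List (Fin n)) :
    complProd c (l.map Fin.succ) = -c 0 * complProd (fun i => c i.succ) l := by
  simp [complProd, Fin.prod_univ_succ, Fin.succ_ne_zero]

theorem complProd_insertIdx {n : ℕ} (c : Fin (n + 1) → ℝ) (l : List (Fin n)) (p : ℕ)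
    (hp : p ≤ l.length) :
    complProd c ((l.map Fin.succ).insertIdx p 0) = complProd (fun i => c i.succ) l := by
  have : ∀ i, i ∈ (l.map Fin.succ).insertIdx p 0 ↔ i = 0 ∨ i ∈ l.map Fin.succ := fun i =>
    List.mem_insertIdx (by simpa using hp)
  simp [complProd, Fin.prod_univ_succ, this, Fin.succ_ne_zero]

/-- The vertices of the body are indexed by duplicate-free lists of coordinates. For every
functional `c` with distinct nonzero entries and every shift `s`, the volume is the sum of their
contributions. The shift is what makes the induction on the dimension work. -/
theorem volume_real_weakMajorizationBody (n : ℕ) (c : Fin n → ℝ) (hc : Function.Injective c)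
    (hc0 : ∀ i, c i ≠ 0) (α : ℕ → ℝ) (hα : Antitone α) (hα0 : ∀ i, 0 ≤ α i) (s : ℝ) :
    volume.real (weakMajorizationBody n α) =
      ∑ l : {l : List (Fin n) // l.Nodup},
        (s + listDot (l.1.map c) α) ^ n / (n ! : ℝ) / (listDen (l.1.map c) * complProd c l.1) := by
  induction n generalizing α s with
  | zero =>
    have h1 : weakMajorizationBody 0 α = Set.univ := by
      ext x
      simp [weakMajorizationBody, Finset.eq_empty_of_isEmpty]
    rw [h1, Fintype.sum_eq_single ⟨[], List.nodup_nil⟩]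
    · simp [listDen, complProd, Measure.real, volume_pi]
    · rintro ⟨l, hl⟩ h
      cases l with
      | nil => simp at h
      | cons a l => exact a.elim0
  | succ n ih =>
    -- Truncating `α` after `n + 1` terms changes neither side.
    wlog hend : α (n + 1) = 0 generalizing α
    · have hβ := this (fun i => if i < n + 1 then α i else 0) ?_ ?_ (by simp)
      · rw [weakMajorizationBody_congr (β := α) fun i hi => by simp [hi]] at hβ
        rw [hβ]
        refine Finset.sum_congr rfl fun l _ => ?_
        congr 4
        refine listDot_congr _ fun i hi => ?_
        have := l.2.length_le_card
        simp only [Fintype.card_fin, List.length_map] at this hi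
        simp [hi.trans_le this]
      · intro i j hij
        have := hα hij
        have := hα0 i
        dsimp only
        split_ifs
        · assumption
        · omega
        · assumption
        · exact le_rfl
      · intro i
        split_ifs
        · exact hα0 i
        · exact le_rfl
    set c' : Fin n → ℝ := fun i => c i.succ
    have hc' : Function.Injective c' := hc.comp (Fin.succ_injective n)
    have hIH : ∀ j, ∀ t ∈ Set.Icc (α (j + 1)) (α j),
        volume.real (weakMajorizationBody n (sliceParam α j t)) =
          ∑ l : {l : List (Fin n) // l.Nodup},
            (s + c 0 * t + listDot (l.1.map c') (sliceParam α j t)) ^ n / (n ! : ℝ) /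
              (listDen (l.1.map c') * complProd c' l.1) := fun j t ht =>
      ih c' hc' (fun i => hc0 _) _ (sliceParam_antitone hα ht) (sliceParam_nonneg hα0 ht.2) _
    have hcont : ∀ (w : List ℝ) (j : ℕ), Continuous fun t =>
        (s + c 0 * t + listDot w (sliceParam α j t)) ^ n / (n ! : ℝ) := by
      intro w j
      have : Continuous fun t => listDot w (sliceParam α j t) := by
        rcases lt_or_ge j w.length with h | h
        · have e : (fun t => listDot w (sliceParam α j t)) = fun t =>
              listDot (w.insertIdx j 0) α + (0 - w.getD j 0) * (t - α j) := by
            funext t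
            rw [← listDot_sliceParam 0 w α j h t, zero_mul, zero_add]
          rw [e]
          fun_prop
        · simp only [listDot_sliceParam_of_length_le _ _ _ h]
          fun_prop
      fun_prop
    rw [volume_real_weakMajorizationBody_succ n hα hα0 hend,
      sum_nodup_list_fin_succ fun l => (s + listDot (l.map c) α) ^ (n + 1) / ((n + 1)! : ℝ) /
        (listDen (l.map c) * complProd c l)]
    · have hint : ∀ j ∈ Finset.range (n + 1),
          (∫ t in α (j + 1)..α j, volume.real (weakMajorizationBody n (sliceParam α j t))) =
          ∑ l : {l : List (Fin n) // l.Nodup},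
            (∫ t in α (j + 1)..α j,
              (s + c 0 * t + listDot (l.1.map c') (sliceParam α j t)) ^ n / (n ! : ℝ)) /
                (listDen (l.1.map c') * complProd c' l.1) := by
        intro j _
        rw [intervalIntegral.integral_congr (g := fun t =>
          ∑ l : {l : List (Fin n) // l.Nodup},
            (s + c 0 * t + listDot (l.1.map c') (sliceParam α j t)) ^ n / (n ! : ℝ) /
              (listDen (l.1.map c') * complProd c' l.1))]
        · rw [intervalIntegral.integral_finsetSum]
          · simp only [intervalIntegral.integral_div]
          · exact fun l _ => ((hcont _ j).div_const _).intervalIntegrable _ _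
        · rw [Set.uIcc_of_le (hα (Nat.le_succ j))]
          exact hIH j
      rw [Finset.sum_congr rfl hint, Finset.sum_comm]
      refine Finset.sum_congr rfl fun l _ => ?_
      have hnd : (l.1.map c' ++ [0]).Nodup := by
        rw [List.nodup_append]
        refine ⟨l.2.map hc', by simp, ?_⟩
        intro a ha b hb
        obtain ⟨i, _, rfl⟩ := List.mem_map.1 ha
        rw [List.mem_singleton.1 hb]
        exact hc0 _
      have hnot : c 0 ∉ l.1.map c' := by
        intro h
        obtain ⟨i, _, hi⟩ := List.mem_map.1 h
        exact Fin.succ_ne_zero i (hc hi)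
      have hlen : (l.1.map c').length ≤ n := by
        simpa using l.2.length_le_card
      have key := congrArg (· / complProd c' l.1)
        (sum_integral_listDot_sliceParam n (c 0) (hc0 0) _ hnd hnot hlen α hend s)
      simp only [add_div, Finset.sum_div, div_div, List.length_map] at key
      simp only [div_div]
      have hmap : (l.1.map Fin.succ).map c = l.1.map c' := by
        rw [List.map_map]
        rfl
      rw [key]
      congr 1
      · refine Finset.sum_congr rfl fun p hp => ?_
        rw [List.map_insertIdx, hmap, complProd_insertIdx _ _ _ (by simp at hp; omega),
          mul_assoc]
      · rw [hmap, complProd_map_succ]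
        congr 1
        ring
    · intro j _
      exact (continuous_finsetSum _ fun l _ => (hcont _ j).div_const _).continuousOn.congr (hIH j)

/-! ### SIM-bodies and reindexing by subsets and permutations -/

/-- The extension of a finite sequence by zeros. -/
def extendByZero {n : ℕ} (α : Fin n → ℝ) (i : ℕ) : ℝ :=
  if h : i < n then α ⟨i, h⟩ else 0

theorem extendByZero_apply {n : ℕ} (α : Fin n → ℝ) (i : Fin n) : extendByZero α i = α i := by
  simp [extendByZero]

theorem extendByZero_nonneg {n : ℕ} {α : Fin n → ℝ} (hα0 : ∀ i, 0 ≤ α i) (i : ℕ) :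
    0 ≤ extendByZero α i := by
  unfold extendByZero
  split_ifs
  · exact hα0 _
  · exact le_rfl

theorem extendByZero_antitone {n : ℕ} {α : Fin n → ℝ} (hα : Antitone α) (hα0 : ∀ i, 0 ≤ α i) :
    Antitone (extendByZero α) := by
  intro i j hij
  unfold extendByZero
  split_ifs
  · exact hα hij
  · omega
  · exact hα0 _
  · exact le_rfl

/-- The height of the complement of an `m`-element set and the bound for the sum of `m` coordinates
add up to the total height. -/
theorem sum_rev_add_sum_range_extendByZero {n : ℕ} (α : Fin n → ℝ) (m : ℕ) (hm : m ≤ n) :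
    ∑ j ∈ Finset.univ.filter (fun j : Fin n => (j : ℕ) + 1 < n + 1 - m), α j.rev +
      ∑ i ∈ Finset.range m, extendByZero α i = ∑ i, α i := by
  have h1 : ∑ j ∈ Finset.univ.filter (fun j : Fin n => (j : ℕ) + 1 < n + 1 - m), α j.rev =
      ∑ i : Fin n, if m ≤ (i : ℕ) then α i else 0 := by
    rw [Finset.sum_filter, ← Equiv.sum_comp Fin.revPerm]
    refine Finset.sum_congr rfl fun i _ => ?_
    have := i.2
    simp only [Fin.revPerm_apply, Fin.rev_rev, Fin.val_rev]
    congr 1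
    exact propext ⟨fun h => by omega, fun h => by omega⟩
  have h2 : ∑ i ∈ Finset.range m, extendByZero α i =
      ∑ i : Fin n, if (i : ℕ) < m then α i else 0 := by
    simp only [← extendByZero_apply α]
    rw [Fin.sum_univ_eq_sum_range (fun i => if i < m then extendByZero α i else 0) n,
      ← Finset.sum_filter]
    refine Finset.sum_congr ?_ fun _ _ => rfl
    ext i
    simp only [Finset.mem_range, Finset.mem_filter]
    omega
  rw [h1, h2, ← Finset.sum_add_distrib]
  refine Finset.sum_congr rfl fun i _ => ?_
  rcases lt_or_ge (i : ℕ) m with h | h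
  · simp [h, not_le.2 h]
  · simp [h, not_lt.2 h]

theorem simHeight_univ_sub_simHeight_compl {n : ℕ} (α : Fin n → ℝ) {I : Finset (Fin (n + 1))}
    (hI : Fin.last n ∉ I) :
    simHeight α Finset.univ - simHeight α Iᶜ = ∑ i ∈ Finset.range #I, extendByZero α i := by
  have hcard : #I ≤ n := by
    have := Finset.card_lt_univ_of_notMem hI
    simp at this
    omega
  have h0 := sum_rev_add_sum_range_extendByZero α 0 (Nat.zero_le _)
  have h1 := sum_rev_add_sum_range_extendByZero α #I hcard
  simp only [simHeight, Finset.mem_univ, if_true, Finset.mem_compl, hI, not_false_eq_true,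
    Finset.card_univ, Fintype.card_fin, Finset.card_compl]
  simp only [Finset.range_zero, Finset.sum_empty, Nat.sub_zero, add_zero] at h0
  linarith

/-- The inequalities for sets containing the last coordinate say that the other coordinates are
nonnegative; those for sets avoiding it are the polymatroid inequalities. The last coordinate is
determined by the equation. -/
theorem simBody_eq_weakMajorizationBody {n : ℕ} (α : Fin n → ℝ) :
    simBody α = weakMajorizationBody n (extendByZero α) := by
  have hsplit : ∀ (y : Fin (n + 1) → ℝ) (I : Finset (Fin (n + 1))),
      ∑ i ∈ I, y i + ∑ i ∈ Iᶜ, y i = ∑ i, y i := fun y I => Finset.sum_add_sum_compl I y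
  ext x
  constructor
  · rintro ⟨y, ⟨hy, hyI⟩, rfl⟩
    refine ⟨fun i => ?_, fun I => ?_⟩
    -- Nonnegativity of `x i` is the inequality for the complement of `{i}`.
    · have hne : Fin.last n ≠ i.castSucc := (Fin.castSucc_lt_last i).ne'
      have h := hyI {i.castSucc}ᶜ ⟨Fin.last n, by simpa using hne⟩
      have h' := hsplit y {i.castSucc}
      rw [Finset.sum_singleton] at h'
      have hz : simHeight α ({i.castSucc}ᶜ)ᶜ = 0 := by simp [simHeight, hne]
      rw [hz] at h
      dsimp only
      linarith
    · rcases I.eq_empty_or_nonempty with rfl | hI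
      · simp
      · have hlast : Fin.last n ∉ I.map Fin.castSuccEmb := by
          simp [Fin.castSucc_ne_last]
        have h := hyI (I.map Fin.castSuccEmb) (hI.map)
        rw [simHeight_univ_sub_simHeight_compl α hlast] at h
        simpa using h
  · rintro ⟨h0, h⟩
    set y : Fin (n + 1) → ℝ := Fin.snoc x (simHeight α Finset.univ - ∑ i, x i) with hy
    have hyc : ∀ i : Fin n, y i.castSucc = x i := fun i => by simp [hy]
    have hsum : ∑ i, y i = simHeight α Finset.univ := by
      rw [Fin.sum_univ_castSucc]
      simp [hy]
    refine ⟨y, ⟨hsum, fun I _ => ?_⟩, funext hyc⟩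
    by_cases hI : Fin.last n ∈ I
    · have hz : simHeight α Iᶜ = 0 := by simp [simHeight, hI]
      have hpos : 0 ≤ ∑ i ∈ Iᶜ, y i := by
        refine Finset.sum_nonneg fun i hi => ?_
        have hne : i ≠ Fin.last n := by
          rintro rfl
          exact Finset.mem_compl.1 hi hI
        obtain ⟨k, rfl⟩ := Fin.exists_castSucc_eq.2 hne
        rw [hyc]
        exact h0 k
      rw [hz]
      linarith [hsplit y I]
    · obtain ⟨J, rfl⟩ : ∃ J : Finset (Fin n), J.map Fin.castSuccEmb = I := by
        refine ⟨Finset.univ.filter fun i => i.castSucc ∈ I, ?_⟩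
        ext i
        induction i using Fin.lastCases with
        | last => simp [hI, Fin.castSucc_ne_last]
        | cast i => simp
      rw [simHeight_univ_sub_simHeight_compl α hI]
      simpa [hyc] using h J

theorem listDot_ofFn {k : ℕ} (w : Fin k → ℝ) (α : ℕ → ℝ) :
    listDot (List.ofFn w) α = ∑ i, w i * α i := by
  induction k generalizing α with
  | zero => simp [listDot]
  | succ k ih => simp [List.ofFn_succ, listDot, ih, Fin.sum_univ_succ]

theorem listDen_ofFn {m : ℕ} (w : Fin (m + 1) → ℝ) :
    listDen (List.ofFn w) = w (Fin.last m) * ∏ i : Fin m, (w i.castSucc - w i.succ) := by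
  induction m with
  | zero => simp [listDen]
  | succ m ih =>
    rw [List.ofFn_succ, listDen, ih, Fin.prod_univ_succ, List.ofFn_succ]
    simp only [List.headD_cons, Fin.succ_last, Fin.castSucc_zero, Fin.castSucc_succ]
    ring

/-- The list of the elements of a finite subset of `Fin n` in the order prescribed by `σ`. -/
def permutedList {n k : ℕ} (L : {L : Finset (Fin n) // #L = k}) (σ : Equiv.Perm (Fin k)) :
    List (Fin n) :=
  List.ofFn fun i => L.1.orderEmbOfFin L.2 (σ⁻¹ i)

theorem permutedList_nodup {n k : ℕ} (L : {L : Finset (Fin n) // #L = k})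
    (σ : Equiv.Perm (Fin k)) : (permutedList L σ).Nodup :=
  List.nodup_ofFn.2 ((L.1.orderEmbOfFin L.2).injective.comp σ⁻¹.injective)

theorem mem_permutedList {n k : ℕ} {L : {L : Finset (Fin n) // #L = k}}
    {σ : Equiv.Perm (Fin k)} {a : Fin n} : a ∈ permutedList L σ ↔ a ∈ L.1 := by
  rw [permutedList, List.mem_ofFn, ← Finset.mem_coe, ← Finset.range_orderEmbOfFin L.1 L.2]
  exact (Equiv.surjective σ⁻¹).exists (p := fun i => L.1.orderEmbOfFin L.2 i = a) |>.symm

/-- Nonempty duplicate-free lists correspond to pairs of a nonempty subset and a permutation. The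
index `m` is the size of the subset minus one. -/
theorem sum_nodup_list_eq_sum_permutedList {n : ℕ} (g : List (Fin n) → ℝ) (hg : g [] = 0) :
    ∑ l : {l : List (Fin n) // l.Nodup}, g l.1 =
      ∑ m : Fin n, ∑ L : {L : Finset (Fin n) // #L = (m : ℕ) + 1},
        ∑ σ : Equiv.Perm (Fin ((m : ℕ) + 1)), g (permutedList L σ) := by
  simp only [Finset.sum_sigma']
  symm
  refine Finset.sum_of_injOn (fun x => ⟨permutedList x.2.1 x.2.2, permutedList_nodup _ _⟩)
    ?_ (by simp) ?_ (by simp)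
  · rintro ⟨m, L, σ⟩ _ ⟨m', L', σ'⟩ _ h
    simp only [Subtype.mk.injEq] at h
    have hm := congrArg List.length h
    simp only [permutedList, List.length_ofFn, Nat.add_right_cancel_iff] at hm
    obtain rfl := Fin.ext hm
    have hL : L = L' := by
      ext a
      rw [← mem_permutedList (σ := σ), h, mem_permutedList]
    subst hL
    have hσ : σ⁻¹ = σ'⁻¹ := by
      ext1 i
      exact (L.1.orderEmbOfFin L.2).injective (congrFun (List.ofFn_injective h) i)
    rw [inv_injective hσ]
  · rintro ⟨l, hl⟩ _ h
    by_contra hne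
    apply h
    have hl0 : l ≠ [] := by
      rintro rfl
      exact hne hg
    have hlen := List.length_pos_iff.2 hl0
    have hle := hl.length_le_card
    rw [Fintype.card_fin] at hle
    obtain ⟨m, hm⟩ : ∃ m, l.length = m + 1 := ⟨l.length - 1, by omega⟩
    have hcard : #l.toFinset = m + 1 := by rw [List.toFinset_card_of_nodup hl, hm]
    -- The position of the `i`-th entry of `l` in the sorted order.
    let f : Fin (m + 1) → Fin (m + 1) := fun i =>
      (l.toFinset.orderIsoOfFin hcard).symm ⟨l[i], by simp⟩
    have hf : Function.Injective f := by
      intro i j hij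
      have := (l.toFinset.orderIsoOfFin hcard).symm.injective hij
      simp only [Subtype.mk.injEq] at this
      exact Fin.ext ((hl.getElem_inj_iff).1 this)
    let τ : Equiv.Perm (Fin (m + 1)) := Equiv.ofBijective f (Finite.injective_iff_bijective.1 hf)
    refine ⟨⟨⟨m, by omega⟩, ⟨l.toFinset, hcard⟩, τ⁻¹⟩, by simp, ?_⟩
    simp only [Subtype.mk.injEq, permutedList, inv_inv]
    refine List.ext_getElem (by simp [hm]) fun i h1 h2 => ?_
    rw [List.getElem_ofFn, ← Finset.coe_orderIsoOfFin_apply]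
    simp [τ, f]

theorem mainTheorem5 (n : ℕ) (hn : 1 ≤ n) (α : Fin n → ℝ)
    (hα : Antitone α) (hα0 : ∀ i, 0 ≤ α i) :
    volume (simBody α) ≠ ⊤ ∧
    (volume (simBody α)).toReal =
      1 / (n ! : ℝ) *
        -- the cardinality `k ∈ [n]` is `m + 1`
        ∑ m : Fin n, ∑ L : {L : Finset (Fin n) // #L = (m : ℕ) + 1},
          ∑ σ : Equiv.Perm (Fin ((m : ℕ) + 1)),
            (∑ i : Fin ((m : ℕ) + 1),
                permuteVector σ (sortedVector L) i * α (Fin.castLE m.isLt i)) ^ n /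
              (permuteVector σ (sortedVector L) (Fin.last (m : ℕ)) *
                (∏ i : Fin (m : ℕ),
                  (permuteVector σ (sortedVector L) i.castSucc -
                    permuteVector σ (sortedVector L) i.succ)) *
                ∏ i ∈ L.1ᶜ, (-((i : ℝ) + 1))) := by
  rw [simBody_eq_weakMajorizationBody]
  refine ⟨volume_weakMajorizationBody_ne_top _ _, ?_⟩
  have hinj : Function.Injective fun i : Fin n => (i : ℝ) + 1 := by
    intro i j h
    exact Fin.ext (by simpa using h)
  have key := volume_real_weakMajorizationBody n (fun i : Fin n => (i : ℝ) + 1) hinj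
    (fun i => by positivity) (extendByZero α) (extendByZero_antitone hα hα0)
    (extendByZero_nonneg hα0) 0
  rw [sum_nodup_list_eq_sum_permutedList (fun l =>
    (0 + listDot (l.map fun i : Fin n => (i : ℝ) + 1) (extendByZero α)) ^ n / (n ! : ℝ) /
      (listDen (l.map fun i : Fin n => (i : ℝ) + 1) * complProd (fun i : Fin n => (i : ℝ) + 1) l))
    (by simp [listDot, show n ≠ 0 by omega])] at key
  refine key.trans ?_
  simp only [Finset.mul_sum]
  refine Finset.sum_congr rfl fun m _ => Finset.sum_congr rfl fun L _ =>
    Finset.sum_congr rfl fun σ _ => ?_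
  have hmap : (permutedList L σ).map (fun i : Fin n => (i : ℝ) + 1) =
      List.ofFn (permuteVector σ (sortedVector L)) := by
    rw [permutedList, List.map_ofFn]
    rfl
  have hα' : ∀ i : Fin ((m : ℕ) + 1), extendByZero α i = α (Fin.castLE m.isLt i) := fun i =>
    extendByZero_apply α (Fin.castLE m.isLt i)
  have hprod : complProd (fun i : Fin n => (i : ℝ) + 1) (permutedList L σ) =
      ∏ i ∈ L.1ᶜ, (-((i : ℝ) + 1)) := by
    simp only [complProd, mem_permutedList]
    rw [Finset.compl_eq_univ_sdiff, ← Finset.filter_notMem_eq_sdiff, Finset.prod_filter]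
    exact Finset.prod_congr rfl fun i _ => by by_cases h : i ∈ L.1 <;> simp [h]
  rw [hmap, hprod, listDot_ofFn, listDen_ofFn, zero_add]
  simp only [hα']
  ring
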